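/- Let $\mathcal H=\mathbb C^d$ be a finite-dimensional Hilbert space, let $\mathcal N$ be a non-empty set of states (positive semidefinite operators of trace one) on $\mathcal H$, and let $\sigma$ be a positive semidefinite operator on $\mathcal H$ with $\operatorname{supp}\rho\subseteq\operatorname{supp}\sigma$ for every $\rho\in\mathcal N$. Powers of a positive semidefinite operator are taken on its support only (so $A^0$ is the projection onto $\operatorname{supp}A$), $\log 0:=-\infty$, $\|X\|_1:=\operatorname{Tr}|X|$ is the trace norm, and $\{X>0\}$ is the spectral projection of a self-adjoint operator $X$ corresponding to $(0,\infty)$. For $t>0$ put $$Q_t^{\mathrm{new}}(\rho\|\sigma):=\operatorname{Tr}\bigl(\sigma^{\frac{1-t}{2t}}\rho\,\sigma^{\frac{1-t}{2t}}\bigr)^t,\qquad \psi(t):=\sup_{\rho\in\mathcal N}\log Q_t^{\mathrm{new}}(\rho\|\sigma),$$ and for $a\in\mathbb R$ put $$\varphi(a):=\sup_{0<t\le 1}\{at-\psi(t)\},\qquad \hat\varphi(a):=\sup_{0<t\le 1}\{a(t-1)-\psi(t)\}.$$ For $n\ge 1$ and a test $T$ on $\mathcal H^{\otimes n}$ let $\alpha_n(T):=\sup_{\rho\in\mathcal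 N}\operatorname{Tr}\rho^{\otimes n}(I-T)$ and $\beta_n(T):=\operatorname{Tr}\sigma^{\otimes n}T$ be the type I and type II errors. For every $n\ge1$ let $\mathcal N(n)\subseteq\mathcal N$ be a finite subset, and put $$\delta(\mathcal N(n)):=\sup_{\rho\in\mathcal N}\inf_{\rho'\in\mathcal N(n)}\|\rho-\rho'\|_1\quad(\inf\emptyset:=+\infty),\qquad S_{n,a}:=\Bigl\{e^{-na}\sum_{\rho\in\mathcal N(n)}\rho^{\otimes n}-\sigma^{\otimes n}>0\Bigr\}.$$ (1) For every $n\ge1$ and every $a\in\mathbb R$, $$\alpha_n(S_{n,a})\le|\mathcal N(n)|\,e^{-n\hat\varphi(a)}+n\,\delta(\mathcal N(n)),\qquad \beta_n(S_{n,a})\le|\mathcal N(n)|\,e^{-n\varphi(a)}.$$ (2) Let $V$ be a real linear space of operators on $\mathcal H$ that contains $\mathcal N$ (for instance the space of all self-adjoint operators, of real dimension $(\dim\mathcal H)^2$), and let $D$ be its real dimension. Let $\kappa>0$ and $\delta_n:=e^{-n\kappa}$, and suppose that for every $n\ge1$ the finite set $\mathcal N(n)\subseteq\mathcal N$ satisfies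 $|\mathcal N(n)|\le(1+2/\delta_n)^{D}$ and that every $\rho\in\mathcal N$ has some $\rho'\in\mathcal N(n)$ with $\|\rho-\rho'\|_1<\delta_n$. Then for every $a\in\mathbb R$, $$\limsup_{n\to\infty}\frac1n\log\alpha_n(S_{n,a})\le-\min\{\kappa,\hat\varphi(a)-\kappa D\},\qquad \limsup_{n\to\infty}\frac1n\log\beta_n(S_{n,a})\le-(\varphi(a)-\kappa D).$$ -/

import Mathlib

open Filter
open scoped ENNReal ComplexOrder

namespace CompositeStein

noncomputable section

variable {d : Type*} [Fintype d] [DecidableEq d]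

/-- Density operators (states) on `ℂ^d`: positive semidefinite with trace one. -/
def IsState (ρ : Matrix d d ℂ) : Prop :=
  ρ.PosSemidef ∧ ρ.trace = 1

/-- The support of a positive semidefinite operator, that is, its range
(the orthogonal complement of its kernel). -/
def supp (A : Matrix d d ℂ) : Submodule ℂ (d → ℂ) :=
  LinearMap.range A.mulVecLin

/-- Real powers of a positive semidefinite operator, taken on its support only: eigenvalue `0`
is sent to `0` for every exponent, so `psdPow A 0` is the projection onto the support of `A`. -/
def psdPow (A : Matrix d d ℂ) (p : ℝ) : Matrix d d ℂ :=
  cfc (fun x : ℝ => if 0 < x then x ^ p else 0) A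

/-- The spectral projection `{X > 0}` of a self-adjoint operator `X`. -/
def posProj (X : Matrix d d ℂ) : Matrix d d ℂ :=
  cfc (fun x : ℝ => if 0 < x then (1 : ℝ) else 0) X

/-- The trace norm `‖X‖₁ = Tr |X|`, with `|X| = (X* X)^{1/2}`. -/
def traceNorm (X : Matrix d d ℂ) : ℝ :=
  (psdPow (X.conjTranspose * X) (1 / 2)).trace.re

/-- The operator `ρ^{⊗ n}` on `(ℂ^d)^{⊗ n}`, in the product basis indexed by `Fin n → d`. -/
def tensorPow (n : ℕ) (ρ : Matrix d d ℂ) : Matrix (Fin n → d) (Fin n → d) ℂ :=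
  Matrix.of fun f g => ∏ i, ρ (f i) (g i)

/-- `Q_t^new(ρ‖σ) = Tr (σ^{(1-t)/(2t)} ρ σ^{(1-t)/(2t)})^t`. -/
def Qnew (t : ℝ) (ρ σ : Matrix d d ℂ) : ℝ :=
  (psdPow (psdPow σ ((1 - t) / (2 * t)) * ρ * psdPow σ ((1 - t) / (2 * t))) t).trace.re

/-- `ψ(t) = sup_{ρ ∈ 𝒩} log Q_t^new(ρ‖σ)`, with `log 0 = -∞`. -/
def psi (𝒩 : Set (Matrix d d ℂ)) (σ : Matrix d d ℂ) (t : ℝ) : EReal :=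
  ⨆ ρ ∈ 𝒩, ENNReal.log (ENNReal.ofReal (Qnew t ρ σ))

/-- `φ(a) = sup_{0 < t ≤ 1} (a t - ψ(t))`. -/
def phi (𝒩 : Set (Matrix d d ℂ)) (σ : Matrix d d ℂ) (a : ℝ) : EReal :=
  ⨆ t ∈ Set.Ioc (0 : ℝ) 1, (((a * t : ℝ) : EReal) - psi 𝒩 σ t)

/-- `φ̂(a) = sup_{0 < t ≤ 1} (a (t - 1) - ψ(t))`. -/
def phiHat (𝒩 : Set (Matrix d d ℂ)) (σ : Matrix d d ℂ) (a : ℝ) : EReal :=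
  ⨆ t ∈ Set.Ioc (0 : ℝ) 1, (((a * (t - 1) : ℝ) : EReal) - psi 𝒩 σ t)

/-- `δ(F) = sup_{ρ ∈ 𝒩} inf_{ρ' ∈ F} ‖ρ - ρ'‖₁`; the infimum over the empty set is `∞`. -/
def netRadius (𝒩 : Set (Matrix d d ℂ)) (F : Finset (Matrix d d ℂ)) : ℝ≥0∞ :=
  ⨆ ρ ∈ 𝒩, ⨅ ρ' ∈ F, ENNReal.ofReal (traceNorm (ρ - ρ'))

/-- The Neyman-Pearson test `{e^{-na} ∑_{ρ ∈ F} ρ^{⊗ n} - σ^{⊗ n} > 0}`. -/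
def npTest (σ : Matrix d d ℂ) (F : Finset (Matrix d d ℂ)) (n : ℕ) (a : ℝ) :
    Matrix (Fin n → d) (Fin n → d) ℂ :=
  posProj (((Real.exp (-(n * a)) : ℝ) : ℂ) • (∑ ρ ∈ F, tensorPow n ρ) - tensorPow n σ)

/-- Worst-case type I error `sup_{ρ ∈ 𝒩} Tr ρ^{⊗ n} (I - T)`. -/
def typeI (𝒩 : Set (Matrix d d ℂ)) (n : ℕ) (T : Matrix (Fin n → d) (Fin n → d) ℂ) : ℝ≥0∞ :=
  ⨆ ρ ∈ 𝒩, ENNReal.ofReal ((tensorPow n ρ * (1 - T)).trace.re)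

/-- Type II error `Tr σ^{⊗ n} T`. -/
def typeII (σ : Matrix d d ℂ) (n : ℕ) (T : Matrix (Fin n → d) (Fin n → d) ℂ) : ℝ≥0∞ :=
  ENNReal.ofReal ((tensorPow n σ * T).trace.re)

/-- The exponential rate `limsup_n (1/n) log e_n`, with `log 0 = -∞`. -/
def expRate (e : ℕ → ℝ≥0∞) : EReal :=
  limsup (fun n : ℕ => ((1 / (n : ℝ) : ℝ) : EReal) * ENNReal.log (e n)) atTop

end

end CompositeStein

/-!
Fix `n` and put `A = e^{-na} ∑_{ρ ∈ 𝒩(n)} ρ^{⊗n}` and `B = σ^{⊗n}`. Comparing `A` and `B` with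
their common upper bound `B + (A - B)₊` and using operator monotonicity of `x ↦ x^t` for
`0 ≤ t ≤ 1` gives Audenaert's inequality: the weighted error `Tr A (1 - S) + Tr B S` of the
Neyman-Pearson test `S = {A - B > 0}` is at most `Tr A^t B^{1-t}`.

The Araki–Lieb–Thirring inequality bounds this by `Q_t^new(A‖B)`. For it, pinch `A` along the
spectral projections of `B`. Pinching costs only a factor proportional to the number of distinct
eigenvalues of `B`, which for `B^{⊗m}` grows polynomially in `m`; since both sides are
multiplicative under tensor powers, the factor disappears by taking `m`-th roots.

Rotfel'd's inequality, that `X ↦ Tr X^t` is subadditive on positive operators, splits `Q_t^new`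
of the sum defining `A` into the terms `Q_t^new(ρ^{⊗n}‖σ^{⊗n}) = Q_t^new(ρ‖σ)^n`, each at most
`e^{nψ(t)}`. Optimizing over `t` bounds both errors for the states of the net `𝒩(n)`. A general
state is moved to the net by replacing one tensor factor at a time, each replacement costing at
most its trace-norm distance to the net. The rates follow because the cardinality of the net grows
at most like `e^{nκD}`.
-/

namespace CompositeStein

open Matrix
open scoped MatrixOrder Matrix.Norms.L2Operator

section Trace

variable {n : Type*} [Fintype n]

theorem trace_mul_nonneg {𝕜 : Type*} [RCLike 𝕜] {A B : Matrix n n 𝕜} (hA : 0 ≤ A) (hB : 0 ≤ B) :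
    0 ≤ (A * B).trace := by
  classical
  obtain ⟨K, rfl⟩ := CStarAlgebra.nonneg_iff_eq_star_mul_self.mp hA
  rw [Matrix.mul_assoc, trace_mul_comm]
  exact (nonneg_iff_posSemidef.mp (star_right_conjugate_nonneg hB K)).trace_nonneg

theorem re_trace_mono {A B : Matrix n n ℂ} (h : A ≤ B) : A.trace.re ≤ B.trace.re := by
  simpa [trace_sub] using (Complex.le_def.mp (le_iff.mp h).trace_nonneg).1

theorem re_trace_mul_le_re_trace_mul_right {A B C : Matrix n n ℂ} (h : A ≤ B) (hC : 0 ≤ C) :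
    (A * C).trace.re ≤ (B * C).trace.re := by
  simpa [sub_mul] using (Complex.le_def.mp (trace_mul_nonneg (sub_nonneg.mpr h) hC)).1

theorem re_trace_mul_le_re_trace_mul_left {A B C : Matrix n n ℂ} (h : A ≤ B) (hC : 0 ≤ C) :
    (C * A).trace.re ≤ (C * B).trace.re := by
  simpa only [trace_mul_comm C] using re_trace_mul_le_re_trace_mul_right h hC

end Trace

section PsdPow

variable {n : Type*} [Fintype n] [DecidableEq n]

theorem continuousOn_spectrum (f : ℝ → ℝ) (A : Matrix n n ℂ) : ContinuousOn f (spectrum ℝ A) :=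
  A.finite_real_spectrum.continuousOn f

theorem cfc_mul_cfc (f g : ℝ → ℝ) (A : Matrix n n ℂ) :
    cfc f A * cfc g A = cfc (fun x => f x * g x) A :=
  (cfc_mul f g A (continuousOn_spectrum f A) (continuousOn_spectrum g A)).symm

theorem trace_cfc {A : Matrix n n ℂ} (hA : A.IsHermitian) (f : ℝ → ℝ) :
    (cfc f A).trace = ∑ i, (f (hA.eigenvalues i) : ℂ) := by
  rw [hA.cfc_eq, IsHermitian.cfc, Unitary.conjStarAlgAut_apply, trace_mul_cycle]
  simp

theorem trace_cfc_mul_conjTranspose_comm (K : Matrix n n ℂ) (f : ℝ → ℝ) :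
    (cfc f (K * Kᴴ)).trace = (cfc f (Kᴴ * K)).trace := by
  have hl := isHermitian_mul_conjTranspose_self K
  have hr := isHermitian_conjTranspose_mul_self K
  rw [trace_cfc hl, trace_cfc hr,
    (IsHermitian.eigenvalues_eq_eigenvalues_iff hl hr).mpr (charpoly_mul_comm _ _)]

theorem psdPow_nonneg (A : Matrix n n ℂ) (p : ℝ) : 0 ≤ psdPow A p :=
  cfc_nonneg fun x _ => by split_ifs <;> positivity

theorem isSelfAdjoint_psdPow (A : Matrix n n ℂ) (p : ℝ) : IsSelfAdjoint (psdPow A p) :=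
  .of_nonneg (psdPow_nonneg A p)

theorem psdPow_mul_psdPow (A : Matrix n n ℂ) (p q : ℝ) :
    psdPow A p * psdPow A q = psdPow A (p + q) := by
  rw [psdPow, psdPow, psdPow, cfc_mul_cfc]
  refine cfc_congr fun x _ => ?_
  by_cases hx : 0 < x <;> simp [hx, Real.rpow_add]

theorem psdPow_one {A : Matrix n n ℂ} (hA : 0 ≤ A) : psdPow A 1 = A := by
  rw [psdPow]
  conv_rhs => rw [← cfc_id' ℝ A]
  refine cfc_congr fun x hx => ?_
  have hx0 : 0 ≤ x := spectrum_nonneg_of_nonneg hA hx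
  grind [Real.rpow_one]

theorem psdPow_zero_le_one (A : Matrix n n ℂ) : psdPow A 0 ≤ 1 :=
  cfc_le_one _ _ fun x _ => by split_ifs <;> simp

theorem psdPow_smul {A : Matrix n n ℂ} (hA : IsSelfAdjoint A) {c : ℝ} (hc : 0 < c) (p : ℝ) :
    psdPow (c • A) p = c ^ p • psdPow A p := by
  rw [psdPow, psdPow, ← cfc_comp_const_mul c _ A ((A.finite_real_spectrum.image _).continuousOn _),
    ← cfc_const_mul _ _ _ (continuousOn_spectrum _ A)]
  refine cfc_congr fun x _ => ?_
  by_cases hx : 0 < x <;> simp [hx, hc, Real.mul_rpow hc.le, le_of_lt]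

theorem psdPow_eq_rpow {A : Matrix n n ℂ} (hA : 0 ≤ A) {p : ℝ} (hp : 0 < p) :
    psdPow A p = A ^ p := by
  rw [CFC.rpow_eq_cfc_real (ha := hA)]
  refine cfc_congr fun x hx => ?_
  rcases (spectrum_nonneg_of_nonneg hA hx).eq_or_lt with h | h
  · simp [← h, Real.zero_rpow hp.ne']
  · simp [h]

end PsdPow

section OperatorMonotone

variable {n : Type*} [Fintype n] [DecidableEq n]

theorem self_mul_psdPow_zero {A : Matrix n n ℂ} (hA : 0 ≤ A) : A * psdPow A 0 = A := by
  nth_rw 1 [← psdPow_one hA]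
  rw [psdPow_mul_psdPow, add_zero, psdPow_one hA]

theorem psdPow_zero_mul_psdPow_zero_of_le {A B : Matrix n n ℂ} (hA : 0 ≤ A) (hAB : A ≤ B) :
    psdPow A 0 * psdPow B 0 = psdPow A 0 := by
  set F := 1 - psdPow B 0 with hF
  set S := psdPow A (1 / 2)
  have hBF : B * F = 0 := by
    rw [hF, mul_sub, mul_one, self_mul_psdPow_zero (hA.trans hAB), sub_self]
  have hFAF : star F * A * F = 0 := by
    refine le_antisymm ?_ (star_left_conjugate_nonneg hA F)
    simpa [mul_assoc, hBF] using star_left_conjugate_le_conjugate hAB F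
  have hSF : S * F = 0 := by
    rw [← conjTranspose_mul_self_eq_zero, conjTranspose_mul, ← star_eq_conjTranspose,
      ← star_eq_conjTranspose, (isSelfAdjoint_psdPow A _).star_eq, mul_assoc, ← mul_assoc S,
      psdPow_mul_psdPow, add_halves, psdPow_one hA, ← mul_assoc, hFAF]
  have hAF : psdPow A 0 * F = 0 := by
    rw [← neg_add_cancel (1 / 2 : ℝ), ← psdPow_mul_psdPow, mul_assoc, hSF, mul_zero]
  rwa [hF, mul_sub, mul_one, sub_eq_zero, eq_comm] at hAF

theorem psdPow_zero_mono {A B : Matrix n n ℂ} (hA : 0 ≤ A) (hAB : A ≤ B) :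
    psdPow A 0 ≤ psdPow B 0 := by
  have hl := psdPow_zero_mul_psdPow_zero_of_le hA hAB
  have hr : psdPow B 0 * psdPow A 0 = psdPow A 0 := by
    simpa [(isSelfAdjoint_psdPow _ _).star_eq] using congrArg star hl
  calc psdPow A 0 = psdPow B 0 * psdPow A 0 * psdPow B 0 := by rw [hr, hl]
    _ ≤ psdPow B 0 * 1 * psdPow B 0 :=
      conjugate_le_conjugate_of_nonneg (psdPow_zero_le_one A) (psdPow_nonneg B 0)
    _ = psdPow B 0 := by rw [mul_one, psdPow_mul_psdPow, add_zero]

theorem psdPow_le_psdPow {A B : Matrix n n ℂ} (hA : 0 ≤ A) (hAB : A ≤ B) {p : ℝ} (hp0 : 0 ≤ p)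
    (hp1 : p ≤ 1) : psdPow A p ≤ psdPow B p := by
  rcases hp0.eq_or_lt with rfl | hp
  · exact psdPow_zero_mono hA hAB
  · rw [psdPow_eq_rpow hA hp, psdPow_eq_rpow (hA.trans hAB) hp]
    exact CFC.rpow_le_rpow ⟨hp0, hp1⟩ hAB

end OperatorMonotone

section Audenaert

variable {n : Type*} [Fintype n] [DecidableEq n]

theorem posProj_nonneg (X : Matrix n n ℂ) : 0 ≤ posProj X :=
  cfc_nonneg fun x _ => by split_ifs <;> simp

theorem posProj_le_one (X : Matrix n n ℂ) : posProj X ≤ 1 :=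
  cfc_le_one _ _ fun x _ => by split_ifs <;> simp

theorem self_mul_posProj {X : Matrix n n ℂ} (hX : IsSelfAdjoint X) : X * posProj X = X⁺ := by
  nth_rw 1 [← cfc_id' ℝ X]
  rw [posProj, cfc_mul_cfc, CFC.posPart_def,
    cfcₙ_eq_cfc (hf := continuous_posPart.continuousOn) (hf0 := posPart_zero)]
  refine cfc_congr fun x _ => ?_
  rcases lt_or_ge 0 x with hx | hx <;> simp [hx, le_of_lt, not_lt.mpr]

theorem re_trace_posProj_error_le {A B : Matrix n n ℂ} (hA : 0 ≤ A) (hB : 0 ≤ B) {t : ℝ}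
    (ht0 : 0 ≤ t) (ht1 : t ≤ 1) :
    (A * (1 - posProj (A - B))).trace.re + (B * posProj (A - B)).trace.re
      ≤ (psdPow A t * psdPow B (1 - t)).trace.re := by
  set C := B + (A - B)⁺ with hC_def
  have hX : IsSelfAdjoint (A - B) := (IsSelfAdjoint.of_nonneg hA).sub (.of_nonneg hB)
  have hBC : B ≤ C := le_add_of_nonneg_right (CFC.posPart_nonneg _)
  have hAC : A ≤ C := sub_le_iff_le_add'.mp (CFC.le_posPart hX)
  have hpow_sub : 0 ≤ psdPow C (1 - t) - psdPow B (1 - t) :=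
    sub_nonneg.mpr (psdPow_le_psdPow hB hBC (by linarith) (by linarith))
  have hself {M : Matrix n n ℂ} (hM : 0 ≤ M) : psdPow M t * psdPow M (1 - t) = M := by
    rw [psdPow_mul_psdPow, add_sub_cancel, psdPow_one hM]
  have key : A.trace.re - (psdPow A t * psdPow B (1 - t)).trace.re ≤ ((A - B)⁺).trace.re := by
    calc A.trace.re - (psdPow A t * psdPow B (1 - t)).trace.re
        = (psdPow A t * (psdPow A (1 - t) - psdPow B (1 - t))).trace.re := by
          rw [mul_sub, hself hA, trace_sub, Complex.sub_re]
      _ ≤ (psdPow A t * (psdPow C (1 - t) - psdPow B (1 - t))).trace.re :=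
          re_trace_mul_le_re_trace_mul_left
            (sub_le_sub_right (psdPow_le_psdPow hA hAC (by linarith) (by linarith)) _)
            (psdPow_nonneg A t)
      _ ≤ (psdPow C t * (psdPow C (1 - t) - psdPow B (1 - t))).trace.re :=
          re_trace_mul_le_re_trace_mul_right (psdPow_le_psdPow hA hAC ht0 ht1) hpow_sub
      _ = C.trace.re - (psdPow C t * psdPow B (1 - t)).trace.re := by
          rw [mul_sub, hself (hA.trans hAC), trace_sub, Complex.sub_re]
      _ ≤ C.trace.re - (psdPow B t * psdPow B (1 - t)).trace.re :=
          sub_le_sub_left (re_trace_mul_le_re_trace_mul_right (psdPow_le_psdPow hB hBC ht0 ht1)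
            (psdPow_nonneg B _)) _
      _ = ((A - B)⁺).trace.re := by
          rw [hself hB, hC_def, trace_add, Complex.add_re, add_sub_cancel_left]
  have hsplit : A * (1 - posProj (A - B)) + B * posProj (A - B) = A - (A - B)⁺ := by
    rw [← self_mul_posProj hX]
    noncomm_ring
  rw [← Complex.add_re, ← trace_add, hsplit, trace_sub, Complex.sub_re]
  linarith

end Audenaert

section Rotfeld

variable {n : Type*} [Fintype n] [DecidableEq n]

theorem conjTranspose_mul_self_le_one {K : Matrix n n ℂ} (hK : K * Kᴴ ≤ 1) : Kᴴ * K ≤ 1 := by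
  rw [← star_eq_conjTranspose] at hK ⊢
  rw [← CStarAlgebra.norm_le_one_iff_of_nonneg _ (mul_star_self_nonneg K),
    CStarRing.norm_self_mul_star] at hK
  rwa [← CStarAlgebra.norm_le_one_iff_of_nonneg _ (star_mul_self_nonneg K),
    CStarRing.norm_star_mul_self]

theorem psdPow_conj_le_one {X C : Matrix n n ℂ} (hX : 0 ≤ X) (hXC : X ≤ C) {s : ℝ} (hs0 : 0 ≤ s)
    (hs1 : s ≤ 1) :
    psdPow X ((1 - s) / 2) * psdPow C (s - 1) * psdPow X ((1 - s) / 2) ≤ 1 := by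
  set L := psdPow X ((1 - s) / 2)
  set M := psdPow C ((s - 1) / 2)
  have hMM : M * M = psdPow C (s - 1) := by rw [psdPow_mul_psdPow, add_halves]
  have hLstar : Lᴴ = L := isSelfAdjoint_psdPow X _
  have hMstar : Mᴴ = M := isSelfAdjoint_psdPow C _
  have hML : (M * L) * (M * L)ᴴ ≤ 1 :=
    calc (M * L) * (M * L)ᴴ = M * (L * L) * M := by
          rw [conjTranspose_mul, hLstar, hMstar]; simp only [Matrix.mul_assoc]
      _ = M * psdPow X (1 - s) * M := by rw [psdPow_mul_psdPow, add_halves]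
      _ ≤ M * psdPow C (1 - s) * M :=
          conjugate_le_conjugate_of_nonneg
            (psdPow_le_psdPow hX hXC (by linarith) (by linarith)) (psdPow_nonneg C _)
      _ = psdPow C 0 := by
          rw [psdPow_mul_psdPow, psdPow_mul_psdPow]
          congr 1
          ring
      _ ≤ 1 := psdPow_zero_le_one C
  calc L * psdPow C (s - 1) * L = (M * L)ᴴ * (M * L) := by
        rw [← hMM, conjTranspose_mul, hLstar, hMstar]; simp only [Matrix.mul_assoc]
    _ ≤ 1 := conjTranspose_mul_self_le_one hML

theorem re_trace_psdPow_sub_one_mul_le {X C : Matrix n n ℂ} (hX : 0 ≤ X) (hXC : X ≤ C) {s : ℝ}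
    (hs0 : 0 ≤ s) (hs1 : s ≤ 1) :
    (psdPow C (s - 1) * X).trace.re ≤ (psdPow X s).trace.re := by
  set L := psdPow X ((1 - s) / 2) with hL
  have hX_eq : X = L * psdPow X s * L := by
    rw [hL, psdPow_mul_psdPow, psdPow_mul_psdPow]
    ring_nf
    exact (psdPow_one hX).symm
  calc (psdPow C (s - 1) * X).trace.re
      = (L * psdPow C (s - 1) * L * psdPow X s).trace.re := by
        nth_rw 1 [hX_eq]
        rw [← Matrix.mul_assoc, trace_mul_comm]
        simp only [Matrix.mul_assoc]
    _ ≤ (1 * psdPow X s).trace.re :=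
        re_trace_mul_le_re_trace_mul_right (psdPow_conj_le_one hX hXC hs0 hs1) (psdPow_nonneg X s)
    _ = (psdPow X s).trace.re := by rw [one_mul]

/-- **Rotfel'd's inequality.** -/
theorem re_trace_psdPow_sum_le {ι : Type*} (F : Finset ι) {X : ι → Matrix n n ℂ}
    (hX : ∀ i ∈ F, 0 ≤ X i) {s : ℝ} (hs0 : 0 ≤ s) (hs1 : s ≤ 1) :
    (psdPow (∑ i ∈ F, X i) s).trace.re ≤ ∑ i ∈ F, (psdPow (X i) s).trace.re := by
  set C := ∑ i ∈ F, X i with hC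
  calc (psdPow C s).trace.re = (psdPow C (s - 1) * C).trace.re := by
        nth_rw 3 [← psdPow_one (A := C) (Finset.sum_nonneg hX)]
        rw [psdPow_mul_psdPow, sub_add_cancel]
    _ = ∑ i ∈ F, (psdPow C (s - 1) * X i).trace.re := by
        nth_rw 2 [hC]
        rw [Finset.mul_sum, trace_sum, Complex.re_sum]
    _ ≤ ∑ i ∈ F, (psdPow (X i) s).trace.re :=
        Finset.sum_le_sum fun i hi => re_trace_psdPow_sub_one_mul_le (hX i hi)
          (Finset.single_le_sum hX hi) hs0 hs1

theorem re_trace_psdPow_conj_le {Y K : Matrix n n ℂ} (hY : 0 ≤ Y) (hK : K * Kᴴ ≤ 1) {s : ℝ}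
    (hs0 : 0 ≤ s) (hs1 : s ≤ 1) :
    (psdPow (Kᴴ * Y * K) s).trace.re ≤ (psdPow Y s).trace.re := by
  set Z := psdPow Y (1 / 2)
  have hZstar : Zᴴ = Z := isSelfAdjoint_psdPow Y _
  have hZZ : Z * Z = Y := by rw [psdPow_mul_psdPow, add_halves, psdPow_one hY]
  calc (psdPow (Kᴴ * Y * K) s).trace.re = (psdPow ((Z * K)ᴴ * (Z * K)) s).trace.re := by
        rw [conjTranspose_mul, hZstar, Matrix.mul_assoc Kᴴ Z, ← Matrix.mul_assoc Z, hZZ,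
          Matrix.mul_assoc]
    _ = (psdPow ((Z * K) * (Z * K)ᴴ) s).trace.re :=
        congrArg Complex.re (trace_cfc_mul_conjTranspose_comm _ _).symm
    _ ≤ (psdPow Y s).trace.re := by
        refine re_trace_mono (psdPow_le_psdPow (mul_star_self_nonneg (Z * K)) ?_ hs0 hs1)
        calc (Z * K) * (Z * K)ᴴ = Z * (K * Kᴴ) * Z := by
              rw [conjTranspose_mul, hZstar]; simp only [Matrix.mul_assoc]
          _ ≤ Z * 1 * Z := conjugate_le_conjugate_of_nonneg hK (psdPow_nonneg Y _)
          _ = Y := by rw [mul_one, hZZ]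

end Rotfeld

section Pinching

variable {n : Type*} [Fintype n] [DecidableEq n]

theorem le_two_smul_pinching {E A : Matrix n n ℂ} (hE : IsStarProjection E) (hA : 0 ≤ A) :
    A ≤ (2 : ℝ) • (E * A * E + (1 - E) * A * (1 - E)) := by
  have hself : IsSelfAdjoint (E - (1 - E)) := hE.isSelfAdjoint.sub hE.one_sub.isSelfAdjoint
  rw [← sub_nonneg]
  convert hself.conjugate_nonneg hA using 1
  rw [two_smul]
  noncomm_ring

theorem mul_psdPow_eq_zero {E W : Matrix n n ℂ} (hW : 0 ≤ W) (hEW : E * W = 0) (s : ℝ) :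
    E * psdPow W s = 0 := by
  rw [← add_sub_cancel 1 s, ← psdPow_mul_psdPow, psdPow_one hW, ← mul_assoc, hEW, zero_mul]

theorem re_trace_mul_psdPow_le {E A : Matrix n n ℂ} (hE : IsStarProjection E) (hA : 0 ≤ A) {s : ℝ}
    (hs0 : 0 ≤ s) (hs1 : s ≤ 1) :
    (E * psdPow A s).trace.re ≤ 2 ^ s * (psdPow (E * A * E) s).trace.re := by
  set X := E * A * E
  set W := (1 - E) * A * (1 - E)
  have hX : 0 ≤ X := hE.isSelfAdjoint.conjugate_nonneg hA
  have hW : 0 ≤ W := hE.one_sub.isSelfAdjoint.conjugate_nonneg hA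
  have hE0 : 0 ≤ E := hE.nonneg
  have hF0 : 0 ≤ 1 - E := hE.one_sub.nonneg
  have hEW : E * psdPow W s = 0 :=
    mul_psdPow_eq_zero hW (by simp only [W, ← mul_assoc, hE.mul_one_sub_self, zero_mul]) s
  have hpinch : (E * psdPow (X + W) s).trace.re ≤ (psdPow X s).trace.re := by
    have hsum : (psdPow (X + W) s).trace.re ≤ (psdPow X s).trace.re + (psdPow W s).trace.re := by
      simpa using re_trace_psdPow_sum_le Finset.univ (X := ![X, W]) (by simp [hX, hW]) hs0 hs1
    have hF : (psdPow W s).trace.re ≤ ((1 - E) * psdPow (X + W) s).trace.re := by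
      rw [show psdPow W s = (1 - E) * psdPow W s by rw [sub_mul, hEW, one_mul, sub_zero]]
      exact re_trace_mul_le_re_trace_mul_left
        (psdPow_le_psdPow hW (le_add_of_nonneg_left hX) hs0 hs1) hF0
    rw [sub_mul, one_mul, trace_sub, Complex.sub_re] at hF
    linarith
  calc (E * psdPow A s).trace.re ≤ (E * psdPow ((2 : ℝ) • (X + W)) s).trace.re :=
        re_trace_mul_le_re_trace_mul_left
          (psdPow_le_psdPow hA (le_two_smul_pinching hE hA) hs0 hs1) hE0
    _ = 2 ^ s * (E * psdPow (X + W) s).trace.re := by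
        rw [psdPow_smul (.of_nonneg (add_nonneg hX hW)) two_pos, Matrix.mul_smul, trace_smul,
          Complex.smul_re, smul_eq_mul]
    _ ≤ 2 ^ s * (psdPow X s).trace.re := by gcongr

end Pinching

section SpectralDecomposition

variable {n : Type*} [Fintype n] [DecidableEq n]

/-- The spectral projection of a self-adjoint matrix onto the eigenspace of the real number `k`;
it vanishes when `k` is not an eigenvalue. -/
noncomputable def eigenProj (B : Matrix n n ℂ) (k : ℝ) : Matrix n n ℂ :=
  cfc (fun x : ℝ => if x = k then 1 else 0) B

theorem isStarProjection_eigenProj (B : Matrix n n ℂ) (k : ℝ) :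
    IsStarProjection (eigenProj B k) where
  isIdempotentElem := by
    rw [IsIdempotentElem, eigenProj, cfc_mul_cfc]
    simp only [mul_ite, mul_one, mul_zero, ← ite_and, and_self]
  isSelfAdjoint := cfc_predicate _ _

theorem eigenProj_mul_cfc (B : Matrix n n ℂ) (k : ℝ) (f : ℝ → ℝ) :
    eigenProj B k * cfc f B = f k • eigenProj B k := by
  rw [eigenProj, cfc_mul_cfc, ← cfc_const_mul _ _ _ (continuousOn_spectrum _ B)]
  refine cfc_congr fun x _ => ?_
  by_cases hx : x = k <;> simp [hx]

theorem cfc_mul_eigenProj (B : Matrix n n ℂ) (k : ℝ) (f : ℝ → ℝ) :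
    cfc f B * eigenProj B k = f k • eigenProj B k := by
  rw [eigenProj, (cfc_commute_cfc _ _ B).eq]
  exact eigenProj_mul_cfc B k f

theorem cfc_eq_sum_smul_eigenProj (B : Matrix n n ℂ) (f : ℝ → ℝ) :
    cfc f B = ∑ k ∈ B.finite_real_spectrum.toFinset, f k • eigenProj B k := by
  simp only [eigenProj, ← cfc_const_mul _ _ B (continuousOn_spectrum _ B)]
  rw [← cfc_sum _ _ _ fun k _ => continuousOn_spectrum _ B]
  refine cfc_congr fun x hx => ?_
  simp [Finset.sum_apply, hx]

theorem psdPow_mul_eigenProj {B : Matrix n n ℂ} {k : ℝ} (hk : 0 < k) (p : ℝ) :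
    psdPow B p * eigenProj B k = k ^ p • eigenProj B k := by
  rw [psdPow, cfc_mul_eigenProj, if_pos hk]

theorem eigenProj_mul_psdPow {B : Matrix n n ℂ} {k : ℝ} (hk : 0 < k) (p : ℝ) :
    eigenProj B k * psdPow B p = k ^ p • eigenProj B k := by
  rw [psdPow, eigenProj_mul_cfc, if_pos hk]

end SpectralDecomposition

section WeakArakiLiebThirring

variable {n : Type*} [Fintype n] [DecidableEq n]

theorem psdPow_mul_mul_psdPow_nonneg {A : Matrix n n ℂ} (hA : 0 ≤ A) (B : Matrix n n ℂ) (r : ℝ) :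
    0 ≤ psdPow B r * A * psdPow B r :=
  conjugate_nonneg_of_nonneg hA (psdPow_nonneg B r)

theorem Qnew_nonneg (t : ℝ) (A B : Matrix n n ℂ) : 0 ≤ Qnew t A B := by
  simpa [Qnew] using re_trace_mono (psdPow_nonneg _ t)

theorem rpow_mul_re_trace_psdPow_eigenProj_le {A : Matrix n n ℂ} (hA : 0 ≤ A) (B : Matrix n n ℂ)
    {k s : ℝ} (hk : 0 < k) (hs0 : 0 < s) (hs1 : s ≤ 1) :
    k ^ (1 - s) * (psdPow (eigenProj B k * A * eigenProj B k) s).trace.re ≤ Qnew s A B := by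
  set E := eigenProj B k
  have hE : IsStarProjection E := isStarProjection_eigenProj B k
  set r := (1 - s) / (2 * s) with hr
  set Y := psdPow B r * A * psdPow B r with hY
  have hEYE : E * Y * E = k ^ (2 * r) • (E * A * E) :=
    calc E * Y * E = (E * psdPow B r) * A * (psdPow B r * E) := by simp only [hY, mul_assoc]
      _ = k ^ (2 * r) • (E * A * E) := by
        rw [eigenProj_mul_psdPow hk, psdPow_mul_eigenProj hk, two_mul, Real.rpow_add hk,
          mul_smul_comm, smul_mul_assoc, smul_mul_assoc, smul_smul]
  have hpow : k ^ (1 - s) • psdPow (E * A * E) s = psdPow (E * Y * E) s := by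
    rw [hEYE, psdPow_smul (.of_nonneg (hE.isSelfAdjoint.conjugate_nonneg hA)) (by positivity),
      ← Real.rpow_mul hk.le, hr]
    congr 2
    field_simp
  have hE_le : E * Eᴴ ≤ 1 := by
    rw [← star_eq_conjTranspose, hE.isSelfAdjoint.star_eq, hE.isIdempotentElem.eq]
    exact hE.le_one
  calc k ^ (1 - s) * (psdPow (E * A * E) s).trace.re = (psdPow (E * Y * E) s).trace.re := by
        rw [← hpow, trace_smul, Complex.smul_re, smul_eq_mul]
    _ ≤ (psdPow Y s).trace.re := by
        have h := re_trace_psdPow_conj_le (psdPow_mul_mul_psdPow_nonneg hA B r) hE_le hs0.le hs1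
        rwa [← star_eq_conjTranspose, hE.isSelfAdjoint.star_eq] at h

theorem re_trace_psdPow_mul_psdPow_le_card_mul_Qnew {A : Matrix n n ℂ} (hA : 0 ≤ A)
    (B : Matrix n n ℂ) {s : ℝ} (hs0 : 0 < s) (hs1 : s ≤ 1) :
    (psdPow A s * psdPow B (1 - s)).trace.re
      ≤ 2 ^ s * (spectrum ℝ B).ncard * Qnew s A B := by
  set f : ℝ → ℝ := fun x => if 0 < x then x ^ (1 - s) else 0 with hf
  have hterm (k : ℝ) : f k * (eigenProj B k * psdPow A s).trace.re ≤ 2 ^ s * Qnew s A B := by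
    by_cases hk : 0 < k
    · calc f k * (eigenProj B k * psdPow A s).trace.re
          ≤ k ^ (1 - s) * (2 ^ s * (psdPow (eigenProj B k * A * eigenProj B k) s).trace.re) := by
            simp only [hf, if_pos hk]
            gcongr
            exact re_trace_mul_psdPow_le (isStarProjection_eigenProj B k) hA hs0.le hs1
        _ = 2 ^ s * (k ^ (1 - s) * (psdPow (eigenProj B k * A * eigenProj B k) s).trace.re) := by
            ring
        _ ≤ 2 ^ s * Qnew s A B := by
            gcongr
            exact rpow_mul_re_trace_psdPow_eigenProj_le hA B hk hs0 hs1
    · simpa [hf, hk] using mul_nonneg (by positivity) (Qnew_nonneg s A B)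
  calc (psdPow A s * psdPow B (1 - s)).trace.re
      = ∑ k ∈ B.finite_real_spectrum.toFinset, f k * (eigenProj B k * psdPow A s).trace.re := by
        rw [trace_mul_comm, psdPow, cfc_eq_sum_smul_eigenProj, Finset.sum_mul, trace_sum,
          Complex.re_sum]
        simp only [smul_mul_assoc, trace_smul, Complex.smul_re, smul_eq_mul, hf]
    _ ≤ ∑ k ∈ B.finite_real_spectrum.toFinset, 2 ^ s * Qnew s A B :=
        Finset.sum_le_sum fun k _ => hterm k
    _ = 2 ^ s * (spectrum ℝ B).ncard * Qnew s A B := by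
        rw [Finset.sum_const, nsmul_eq_mul, Set.ncard_eq_toFinset_card _ B.finite_real_spectrum]
        ring

end WeakArakiLiebThirring

section PiTensor

variable {ι n R : Type*} [Fintype ι]

/-- The tensor product `⨂ i, M i` of a finite family of matrices, in the product basis. -/
def piTensor [CommMonoid R] (M : ι → Matrix n n R) : Matrix (ι → n) (ι → n) R :=
  Matrix.of fun f g => ∏ i, M i (f i) (g i)

theorem piTensor_mul [DecidableEq ι] [Fintype n] [CommSemiring R] (M N : ι → Matrix n n R) :
    piTensor M * piTensor N = piTensor fun i => M i * N i := by
  ext f g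
  simp only [piTensor, Matrix.mul_apply, of_apply, ← Finset.prod_mul_distrib]
  rw [Finset.prod_univ_sum, Fintype.piFinset_univ]

theorem conjTranspose_piTensor [CommSemiring R] [StarRing R] (M : ι → Matrix n n R) :
    (piTensor M)ᴴ = piTensor fun i => (M i)ᴴ := by
  ext f g
  simp [piTensor, conjTranspose_apply]

theorem trace_piTensor [DecidableEq ι] [Fintype n] [CommSemiring R] (M : ι → Matrix n n R) :
    (piTensor M).trace = ∏ i, (M i).trace := by
  simp only [piTensor, trace, diag_apply, of_apply]
  rw [Finset.prod_univ_sum, Fintype.piFinset_univ]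

theorem piTensor_diagonal [DecidableEq n] [CommSemiring R] (D : ι → n → R) :
    piTensor (fun i => diagonal (D i)) = diagonal fun f => ∏ i, D i (f i) := by
  ext f g
  simp only [piTensor, of_apply, diagonal_apply]
  split_ifs with h
  · simp [h]
  · obtain ⟨i, hi⟩ := Function.ne_iff.mp h
    exact Finset.prod_eq_zero (Finset.mem_univ i) (if_neg hi)

theorem piTensor_nonneg [Finite n] {M : ι → Matrix n n ℂ} (hM : ∀ i, 0 ≤ M i) :
    0 ≤ piTensor M := by
  classical
  have := Fintype.ofFinite n
  choose K hK using fun i => CStarAlgebra.nonneg_iff_eq_star_mul_self.mp (hM i)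
  rw [show piTensor M = star (piTensor K) * piTensor K by
    rw [star_eq_conjTranspose, conjTranspose_piTensor, piTensor_mul]
    exact congrArg piTensor (funext hK)]
  exact star_mul_self_nonneg _

end PiTensor

section TensorPow

variable {n : Type*}

theorem tensorPow_eq_piTensor (m : ℕ) (A : Matrix n n ℂ) : tensorPow m A = piTensor fun _ => A :=
  rfl

theorem tensorPow_diagonal [DecidableEq n] (m : ℕ) (D : n → ℂ) :
    tensorPow m (diagonal D) = diagonal fun f => ∏ i, D (f i) :=
  piTensor_diagonal _

theorem conjTranspose_tensorPow (m : ℕ) (A : Matrix n n ℂ) : (tensorPow m A)ᴴ = tensorPow m Aᴴ :=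
  conjTranspose_piTensor _

theorem isSelfAdjoint_diagonal_ofReal [DecidableEq n] (D : n → ℝ) :
    IsSelfAdjoint (diagonal fun i => (D i : ℂ)) := by
  simp [IsSelfAdjoint, star_eq_conjTranspose, diagonal_conjTranspose, Pi.star_def]

theorem tensorPow_nonneg [Finite n] (m : ℕ) {A : Matrix n n ℂ} (hA : 0 ≤ A) : 0 ≤ tensorPow m A :=
  piTensor_nonneg fun _ => hA

variable [Fintype n]

theorem tensorPow_mul_tensorPow (m : ℕ) (A B : Matrix n n ℂ) :
    tensorPow m A * tensorPow m B = tensorPow m (A * B) :=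
  piTensor_mul _ _

theorem trace_tensorPow (m : ℕ) (A : Matrix n n ℂ) : (tensorPow m A).trace = A.trace ^ m := by
  simp [tensorPow_eq_piTensor, trace_piTensor]

theorem ncard_range_prod_le (m : ℕ) {R : Type*} [CommMonoid R] (b : n → R) :
    (Set.range fun f : Fin m → n => ∏ i, b (f i)).ncard ≤ (m + 1) ^ Fintype.card n := by
  classical
  have hsub : (Set.range fun f : Fin m → n => ∏ i, b (f i))
      ⊆ Set.range fun c : n → Fin (m + 1) => ∏ j, b j ^ (c j : ℕ) := by
    rintro _ ⟨f, rfl⟩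
    have hcard (j : n) : (Finset.univ.filter fun i => f i = j).card < m + 1 :=
      Nat.lt_succ_of_le ((Finset.card_le_univ _).trans_eq (Fintype.card_fin m))
    refine ⟨fun j => ⟨_, hcard j⟩, ?_⟩
    simp [← Finset.prod_fiberwise' Finset.univ f b]
  calc _ ≤ (Set.range fun c : n → Fin (m + 1) => ∏ j, b j ^ (c j : ℕ)).ncard :=
        Set.ncard_le_ncard hsub (Set.finite_range _)
    _ ≤ Nat.card (n → Fin (m + 1)) := by
        rw [← Set.image_univ, ← Set.ncard_univ]
        exact Set.ncard_image_le
    _ = _ := by simp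

variable [DecidableEq n]

theorem tensorPow_mem_unitaryGroup (m : ℕ) {U : Matrix n n ℂ} (hU : U ∈ unitaryGroup n ℂ) :
    tensorPow m U ∈ unitaryGroup (Fin m → n) ℂ := by
  rw [mem_unitaryGroup_iff, star_eq_conjTranspose] at hU ⊢
  rw [conjTranspose_tensorPow, tensorPow_mul_tensorPow, hU, ← diagonal_one, tensorPow_diagonal]
  simp

theorem spectrum_diagonal_ofReal (D : n → ℝ) :
    spectrum ℝ (diagonal fun i => (D i : ℂ)) = Set.range D := by
  rw [← spectrum.preimage_algebraMap ℂ, spectrum_diagonal]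
  ext x
  simp

theorem cfc_diagonal_ofReal (f : ℝ → ℝ) (D : n → ℝ) :
    cfc f (diagonal fun i => (D i : ℂ)) = diagonal fun i => (f (D i) : ℂ) := by
  let φ : (n → ℝ) →ₐ[ℝ] Matrix n n ℂ := (diagonalAlgHom ℝ).comp (Complex.ofRealAm.compLeft n)
  let p : Polynomial ℝ := Lagrange.interpolate (Finset.univ.image D) id f
  have hp (i : n) : p.eval (D i) = f (D i) :=
    Lagrange.eval_interpolate_at_node f (Set.injOn_id _)
      (Finset.mem_image_of_mem D (Finset.mem_univ i))
  have hφ (E : n → ℝ) : φ E = diagonal fun i => (E i : ℂ) := rfl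
  calc cfc f (diagonal fun i => (D i : ℂ)) = cfc p.eval (diagonal fun i => (D i : ℂ)) := by
        refine cfc_congr fun x hx => ?_
        obtain ⟨i, rfl⟩ := (spectrum_diagonal_ofReal D).le hx
        exact (hp i).symm
    _ = φ (Polynomial.aeval D p) := by
        rw [cfc_polynomial p _ (isSelfAdjoint_diagonal_ofReal D), ← hφ,
          Polynomial.aeval_algHom_apply]
    _ = diagonal fun i => (f (D i) : ℂ) := by
        simp only [hφ, Polynomial.aeval_pi_apply, Polynomial.coe_aeval_eq_eval, hp]

theorem cfc_unitary_conj (f : ℝ → ℝ) {U A : Matrix n n ℂ} (hU : U ∈ unitaryGroup n ℂ)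
    (hA : IsSelfAdjoint A) : cfc f (U * A * Uᴴ) = U * cfc f A * Uᴴ := by
  refine (StarAlgHomClass.map_cfc (Unitary.conjStarAlgAut ℂ (Matrix n n ℂ) ⟨U, hU⟩) f A
    (continuousOn_spectrum f A) ?_ hA (hA.map _)).symm
  rw [funext (Unitary.conjStarAlgAut_apply _)]
  exact (continuous_const.mul continuous_id).mul continuous_const

theorem spectrum_unitary_conj {U : Matrix n n ℂ} (hU : U ∈ unitaryGroup n ℂ) (A : Matrix n n ℂ) :
    spectrum ℝ (U * A * Uᴴ) = spectrum ℝ A :=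
  Unitary.spectrum_star_right_conjugate (U := ⟨U, hU⟩)

theorem exists_eq_unitary_conj_diagonal {A : Matrix n n ℂ} (hA : A.IsHermitian) :
    ∃ U ∈ unitaryGroup n ℂ, A = U * diagonal (fun i => (hA.eigenvalues i : ℂ)) * Uᴴ :=
  ⟨hA.eigenvectorUnitary, hA.eigenvectorUnitary.2, hA.spectral_theorem⟩

theorem tensorPow_unitary_conj_diagonal (m : ℕ) (U : Matrix n n ℂ) (D : n → ℝ) :
    tensorPow m (U * diagonal (fun i => (D i : ℂ)) * Uᴴ)
      = tensorPow m U * diagonal (fun f => ((∏ i, D (f i) : ℝ) : ℂ)) * (tensorPow m U)ᴴ := by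
  simp only [← tensorPow_mul_tensorPow, tensorPow_diagonal, conjTranspose_tensorPow,
    Complex.ofReal_prod]

theorem psdPow_tensorPow (m : ℕ) {A : Matrix n n ℂ} (hA : 0 ≤ A) (p : ℝ) :
    psdPow (tensorPow m A) p = tensorPow m (psdPow A p) := by
  have hpsd := nonneg_iff_posSemidef.mp hA
  obtain ⟨U, hU, hA_eq⟩ := exists_eq_unitary_conj_diagonal hpsd.1
  set D := hpsd.1.eigenvalues
  have hD : ∀ i, 0 ≤ D i := hpsd.eigenvalues_nonneg
  rw [hA_eq, tensorPow_unitary_conj_diagonal, psdPow, psdPow,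
    cfc_unitary_conj _ (tensorPow_mem_unitaryGroup m hU) (isSelfAdjoint_diagonal_ofReal _),
    cfc_unitary_conj _ hU (isSelfAdjoint_diagonal_ofReal _), cfc_diagonal_ofReal,
    cfc_diagonal_ofReal, tensorPow_unitary_conj_diagonal]
  congr! 4 with f
  by_cases h : ∀ i, 0 < D (f i)
  · simp only [h, Finset.prod_pos, implies_true, if_true,
      Real.finsetProd_rpow _ _ fun i _ => hD (f i)]
  · obtain ⟨i, hi⟩ := not_forall.mp h
    have h0 : D (f i) = 0 := le_antisymm (not_lt.mp hi) (hD _)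
    rw [Finset.prod_eq_zero (Finset.mem_univ i) h0,
      Finset.prod_eq_zero (Finset.mem_univ i) (if_neg hi), if_neg (lt_irrefl 0)]

theorem ncard_spectrum_tensorPow_le (m : ℕ) {A : Matrix n n ℂ} (hA : A.IsHermitian) :
    (spectrum ℝ (tensorPow m A)).ncard ≤ (m + 1) ^ Fintype.card n := by
  obtain ⟨U, hU, hA_eq⟩ := exists_eq_unitary_conj_diagonal hA
  rw [hA_eq, tensorPow_unitary_conj_diagonal,
    spectrum_unitary_conj (tensorPow_mem_unitaryGroup m hU), spectrum_diagonal_ofReal]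
  exact ncard_range_prod_le m _

end TensorPow

section ArakiLiebThirring

theorem le_of_forall_pow_le_mul_pow {x y C : ℝ} (hy : 0 ≤ y) (c : ℕ)
    (h : ∀ m : ℕ, x ^ m ≤ C * (m + 1) ^ c * y ^ m) : x ≤ y := by
  by_contra! hlt
  rcases hy.eq_or_lt with rfl | hy0
  · have h1 := h 1
    rw [pow_one, pow_one, mul_zero] at h1
    exact hlt.not_ge h1
  have hr : 1 < x / y := (one_lt_div hy0).mpr hlt
  have hlim : Tendsto (fun m : ℕ => C * (x / y) * ((m + 1 : ℕ) ^ c / (x / y) ^ (m + 1))) atTop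
      (nhds 0) := by
    simpa using (((tendsto_add_atTop_iff_nat 1).mpr
      (tendsto_pow_const_div_const_pow_of_one_lt c hr)).const_mul (C * (x / y)))
  obtain ⟨m, hm⟩ := (hlim.eventually_lt_const one_pos).exists
  have hm' : C * (m + 1) ^ c < (x / y) ^ m := by
    have hr0 : 0 < x / y := one_pos.trans hr
    generalize x / y = r at hm hr0
    rw [← div_lt_one (pow_pos hr0 m)]
    convert hm using 1
    push_cast
    field_simp
    ring
  rw [div_pow, lt_div_iff₀ (by positivity)] at hm'
  exact hm'.not_ge (h m)

theorem re_pow_of_nonneg {z : ℂ} (hz : 0 ≤ z) (m : ℕ) : (z ^ m).re = z.re ^ m := by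
  have hre : z = z.re := Complex.eq_re_of_ofReal_le (r := 0) (by exact_mod_cast hz)
  rw [hre, ← Complex.ofReal_pow, Complex.ofReal_re, Complex.ofReal_re]

variable {n : Type*} [Fintype n] [DecidableEq n]

theorem Qnew_tensorPow (t : ℝ) (m : ℕ) {A B : Matrix n n ℂ} (hA : 0 ≤ A) (hB : 0 ≤ B) :
    Qnew t (tensorPow m A) (tensorPow m B) = Qnew t A B ^ m := by
  rw [Qnew, psdPow_tensorPow m hB, tensorPow_mul_tensorPow, tensorPow_mul_tensorPow,
    psdPow_tensorPow m (psdPow_mul_mul_psdPow_nonneg hA B _), trace_tensorPow, re_pow_of_nonneg,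
    Qnew]
  exact (nonneg_iff_posSemidef.mp (psdPow_nonneg _ _)).trace_nonneg

/-- The **Araki–Lieb–Thirring inequality** for exponents in `(0, 1]`. -/
theorem re_trace_psdPow_mul_psdPow_le_Qnew {A B : Matrix n n ℂ} (hA : 0 ≤ A) (hB : 0 ≤ B) {s : ℝ}
    (hs0 : 0 < s) (hs1 : s ≤ 1) :
    (psdPow A s * psdPow B (1 - s)).trace.re ≤ Qnew s A B := by
  refine le_of_forall_pow_le_mul_pow (C := 2 ^ s) (Qnew_nonneg s A B) (Fintype.card n) fun m => ?_
  calc (psdPow A s * psdPow B (1 - s)).trace.re ^ m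
      = (psdPow (tensorPow m A) s * psdPow (tensorPow m B) (1 - s)).trace.re := by
        rw [psdPow_tensorPow m hA, psdPow_tensorPow m hB, tensorPow_mul_tensorPow,
          trace_tensorPow, re_pow_of_nonneg]
        exact trace_mul_nonneg (psdPow_nonneg _ _) (psdPow_nonneg _ _)
    _ ≤ 2 ^ s * (spectrum ℝ (tensorPow m B)).ncard * Qnew s (tensorPow m A) (tensorPow m B) :=
        re_trace_psdPow_mul_psdPow_le_card_mul_Qnew (tensorPow_nonneg m hA) _ hs0 hs1
    _ ≤ 2 ^ s * (m + 1) ^ Fintype.card n * Qnew s A B ^ m := by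
        rw [Qnew_tensorPow s m hA hB]
        gcongr
        · exact pow_nonneg (Qnew_nonneg s A B) m
        · exact_mod_cast ncard_spectrum_tensorPow_le m (nonneg_iff_posSemidef.mp hB).1

end ArakiLiebThirring

section NeymanPearson

variable {n : Type*} [Fintype n] [DecidableEq n]

theorem Qnew_smul_sum_le {ι : Type*} (F : Finset ι) {A : ι → Matrix n n ℂ} (hA : ∀ i ∈ F, 0 ≤ A i)
    (B : Matrix n n ℂ) {c t : ℝ} (hc : 0 < c) (ht0 : 0 ≤ t) (ht1 : t ≤ 1) :
    Qnew t (c • ∑ i ∈ F, A i) B ≤ c ^ t * ∑ i ∈ F, Qnew t (A i) B := by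
  have hY : ∀ i ∈ F, 0 ≤ psdPow B ((1 - t) / (2 * t)) * A i * psdPow B ((1 - t) / (2 * t)) :=
    fun i hi => psdPow_mul_mul_psdPow_nonneg (hA i hi) B _
  rw [Qnew, Matrix.mul_smul, Matrix.smul_mul, Matrix.mul_sum, Matrix.sum_mul,
    psdPow_smul (.of_nonneg (Finset.sum_nonneg hY)) hc, trace_smul, Complex.smul_re, smul_eq_mul]
  gcongr
  exact re_trace_psdPow_sum_le F hY ht0 ht1

theorem re_trace_npTest_error_le {σ : Matrix n n ℂ} (hσ : 0 ≤ σ) (F : Finset (Matrix n n ℂ))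
    (hF : ∀ ρ ∈ F, 0 ≤ ρ) (m : ℕ) (a : ℝ) {t : ℝ} (ht0 : 0 < t) (ht1 : t ≤ 1) :
    Real.exp (-(m * a)) * ((∑ ρ ∈ F, tensorPow m ρ) * (1 - npTest σ F m a)).trace.re
        + (tensorPow m σ * npTest σ F m a).trace.re
      ≤ Real.exp (-(m * (a * t))) * ∑ ρ ∈ F, Qnew t ρ σ ^ m := by
  set c := Real.exp (-(m * a)) with hc_def
  have hc : 0 < c := Real.exp_pos _
  have hct : Real.exp (-(m * (a * t))) = c ^ t := by
    rw [hc_def, ← Real.exp_mul, neg_mul, mul_assoc]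
  have hsum : ∀ ρ ∈ F, 0 ≤ tensorPow m ρ := fun ρ hρ => tensorPow_nonneg m (hF ρ hρ)
  have hA : 0 ≤ c • ∑ ρ ∈ F, tensorPow m ρ := smul_nonneg hc.le (Finset.sum_nonneg hsum)
  have hB := tensorPow_nonneg m hσ
  calc c * ((∑ ρ ∈ F, tensorPow m ρ) * (1 - npTest σ F m a)).trace.re
        + (tensorPow m σ * npTest σ F m a).trace.re
      = ((c • ∑ ρ ∈ F, tensorPow m ρ) * (1 - npTest σ F m a)).trace.re
        + (tensorPow m σ * npTest σ F m a).trace.re := by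
        rw [Matrix.smul_mul, trace_smul, Complex.smul_re, smul_eq_mul]
    _ ≤ (psdPow (c • ∑ ρ ∈ F, tensorPow m ρ) t * psdPow (tensorPow m σ) (1 - t)).trace.re :=
        re_trace_posProj_error_le hA hB ht0.le ht1
    _ ≤ Qnew t (c • ∑ ρ ∈ F, tensorPow m ρ) (tensorPow m σ) :=
        re_trace_psdPow_mul_psdPow_le_Qnew hA hB ht0 ht1
    _ ≤ c ^ t * ∑ ρ ∈ F, Qnew t (tensorPow m ρ) (tensorPow m σ) :=
        Qnew_smul_sum_le F hsum _ hc ht0.le ht1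
    _ = Real.exp (-(m * (a * t))) * ∑ ρ ∈ F, Qnew t ρ σ ^ m := by
        rw [hct, Finset.sum_congr rfl fun ρ hρ => Qnew_tensorPow t m (hF ρ hρ) hσ]

end NeymanPearson

section NeymanPearsonErrors

variable {n : Type*} [Fintype n] [DecidableEq n]

theorem npTest_nonneg (σ : Matrix n n ℂ) (F : Finset (Matrix n n ℂ)) (m : ℕ) (a : ℝ) :
    0 ≤ npTest σ F m a :=
  posProj_nonneg _

theorem npTest_le_one (σ : Matrix n n ℂ) (F : Finset (Matrix n n ℂ)) (m : ℕ) (a : ℝ) :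
    npTest σ F m a ≤ 1 :=
  posProj_le_one _

theorem re_trace_tensorPow_mul_npTest_le {σ : Matrix n n ℂ} (hσ : 0 ≤ σ)
    {F : Finset (Matrix n n ℂ)} (hF : ∀ ρ ∈ F, 0 ≤ ρ) (m : ℕ) (a : ℝ) {t : ℝ} (ht0 : 0 < t)
    (ht1 : t ≤ 1) :
    (tensorPow m σ * npTest σ F m a).trace.re
      ≤ Real.exp (-(m * (a * t))) * ∑ ρ ∈ F, Qnew t ρ σ ^ m := by
  have hsum : 0 ≤ ((∑ ρ ∈ F, tensorPow m ρ) * (1 - npTest σ F m a)).trace.re :=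
    (Complex.nonneg_iff.mp (trace_mul_nonneg
      (Finset.sum_nonneg fun ρ hρ => tensorPow_nonneg m (hF ρ hρ))
      (sub_nonneg.mpr (npTest_le_one σ F m a)))).1
  exact (le_add_of_nonneg_left (mul_nonneg (Real.exp_pos _).le hsum)).trans
    (re_trace_npTest_error_le hσ F hF m a ht0 ht1)

theorem re_trace_tensorPow_mul_one_sub_npTest_le {σ : Matrix n n ℂ} (hσ : 0 ≤ σ)
    {F : Finset (Matrix n n ℂ)} (hF : ∀ ρ ∈ F, 0 ≤ ρ) {ρ : Matrix n n ℂ} (hρ : ρ ∈ F) (m : ℕ)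
    (a : ℝ) {t : ℝ} (ht0 : 0 < t) (ht1 : t ≤ 1) :
    (tensorPow m ρ * (1 - npTest σ F m a)).trace.re
      ≤ Real.exp (-(m * (a * (t - 1)))) * ∑ ρ ∈ F, Qnew t ρ σ ^ m := by
  have hT : 0 ≤ 1 - npTest σ F m a := sub_nonneg.mpr (npTest_le_one σ F m a)
  have hsingle : tensorPow m ρ ≤ ∑ ρ ∈ F, tensorPow m ρ :=
    Finset.single_le_sum (fun ρ hρ => tensorPow_nonneg m (hF ρ hρ)) hρ
  have hσT : 0 ≤ (tensorPow m σ * npTest σ F m a).trace.re :=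
    (Complex.nonneg_iff.mp (trace_mul_nonneg (tensorPow_nonneg m hσ) (npTest_nonneg σ F m a))).1
  have hexp : Real.exp (-(m * (a * t)))
      = Real.exp (-(m * a)) * Real.exp (-(m * (a * (t - 1)))) := by
    rw [← Real.exp_add]
    ring_nf
  refine (re_trace_mul_le_re_trace_mul_right hsingle hT).trans
    (le_of_mul_le_mul_left ?_ (Real.exp_pos (-(m * a))))
  rw [← mul_assoc, ← hexp]
  exact (le_add_of_nonneg_right hσT).trans (re_trace_npTest_error_le hσ F hF m a ht0 ht1)

end NeymanPearsonErrors

section TraceNorm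

variable {n : Type*} [Fintype n] [DecidableEq n]

theorem traceNorm_eq_re_trace_abs (X : Matrix n n ℂ) : traceNorm X = (CFC.abs X).trace.re := by
  rw [traceNorm, CFC.abs, CFC.sqrt_eq_rpow, ← star_eq_conjTranspose,
    psdPow_eq_rpow (star_mul_self_nonneg X) (by norm_num)]

theorem le_cfcAbs {X : Matrix n n ℂ} (hX : IsSelfAdjoint X) : X ≤ CFC.abs X := by
  rw [← sub_nonneg, CFC.abs_sub_self X hX]
  exact smul_nonneg zero_le_two (CFC.negPart_nonneg X)

end TraceNorm

section Telescoping

variable {ι n R : Type*} [Fintype ι] [DecidableEq ι]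

theorem piTensor_update_apply [CommMonoid R] (M : ι → Matrix n n R) (k : ι) (X : Matrix n n R)
    (f g : ι → n) : piTensor (Function.update M k X) f g
      = X (f k) (g k) * ∏ i ∈ Finset.univ \ {k}, M i (f i) (g i) := by
  simp only [piTensor, of_apply, Function.apply_update (fun i (A : Matrix n n R) => A (f i) (g i)),
    Finset.prod_update_of_mem (Finset.mem_univ k)]

theorem piTensor_update_sub [CommRing R] (M : ι → Matrix n n R) (k : ι) (X Y : Matrix n n R) :
    piTensor (Function.update M k (X - Y))
      = piTensor (Function.update M k X) - piTensor (Function.update M k Y) := by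
  ext f g
  simp only [Matrix.sub_apply, piTensor_update_apply, sub_mul]

theorem trace_piTensor_update [Fintype n] [CommSemiring R] (M : ι → Matrix n n R) (k : ι)
    (X : Matrix n n R) : (piTensor (Function.update M k X)).trace
      = X.trace * ∏ i ∈ Finset.univ \ {k}, (M i).trace := by
  simp only [trace_piTensor, Function.apply_update (fun _ => trace),
    Finset.prod_update_of_mem (Finset.mem_univ k)]

theorem piTensor_update_nonneg [Finite n] {M : ι → Matrix n n ℂ} (hM : ∀ i, 0 ≤ M i) (k : ι)
    {X : Matrix n n ℂ} (hX : 0 ≤ X) : 0 ≤ piTensor (Function.update M k X) :=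
  piTensor_nonneg <| (Function.forall_update_iff M fun _ A => 0 ≤ A).mpr ⟨hX, fun i _ => hM i⟩

variable [Fintype n] [DecidableEq n]

theorem re_trace_piTensor_update_mul_le {M : ι → Matrix n n ℂ} (hM : ∀ i, IsState (M i))
    (k : ι) {X : Matrix n n ℂ} (hX : IsSelfAdjoint X) {T : Matrix (ι → n) (ι → n) ℂ}
    (hT0 : 0 ≤ T) (hT1 : T ≤ 1) :
    (piTensor (Function.update M k X) * T).trace.re ≤ traceNorm X := by
  have hM0 : ∀ i, 0 ≤ M i := fun i => nonneg_iff_posSemidef.mpr (hM i).1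
  have hle : piTensor (Function.update M k X) ≤ piTensor (Function.update M k (CFC.abs X)) := by
    rw [← sub_nonneg, ← piTensor_update_sub]
    exact piTensor_update_nonneg hM0 k (sub_nonneg.mpr (le_cfcAbs hX))
  calc (piTensor (Function.update M k X) * T).trace.re
      ≤ (piTensor (Function.update M k (CFC.abs X)) * T).trace.re :=
        re_trace_mul_le_re_trace_mul_right hle hT0
    _ ≤ (piTensor (Function.update M k (CFC.abs X)) * 1).trace.re :=
        re_trace_mul_le_re_trace_mul_left hT1 (piTensor_update_nonneg hM0 k (CFC.abs_nonneg X))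
    _ = traceNorm X := by
        rw [mul_one, trace_piTensor_update, Finset.prod_eq_one fun i _ => (hM i).2, mul_one,
          traceNorm_eq_re_trace_abs]

theorem re_trace_piTensor_mul_le_add_sum_traceNorm {M N : ι → Matrix n n ℂ}
    (hM : ∀ i, IsState (M i)) (hN : ∀ i, IsState (N i)) {T : Matrix (ι → n) (ι → n) ℂ}
    (hT0 : 0 ≤ T) (hT1 : T ≤ 1) :
    (piTensor M * T).trace.re ≤ (piTensor N * T).trace.re + ∑ i, traceNorm (M i - N i) := by
  suffices h : ∀ S : Finset ι, (piTensor (S.piecewise M N) * T).trace.re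
      ≤ (piTensor N * T).trace.re + ∑ i ∈ S, traceNorm (M i - N i) by
    simpa using h Finset.univ
  intro S
  induction S using Finset.induction_on with
  | empty => simp
  | insert k S hk ih =>
    set P := S.piecewise M N
    have hP (i : ι) : IsState (P i) := S.piecewise_cases M N IsState (hM i) (hN i)
    have hPk : Function.update P k (N k) = P := by
      rw [← S.piecewise_eq_of_notMem M N hk, Function.update_eq_self]
    have hsite := re_trace_piTensor_update_mul_le hP k
      ((hM k).1.1.isSelfAdjoint.sub (hN k).1.1.isSelfAdjoint) hT0 hT1
    rw [piTensor_update_sub, hPk, sub_mul, trace_sub, Complex.sub_re] at hsite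
    rw [Finset.piecewise_insert, Finset.sum_insert hk]
    linarith

theorem re_trace_tensorPow_mul_le_add_traceNorm {ρ ρ' : Matrix n n ℂ} (hρ : IsState ρ)
    (hρ' : IsState ρ') (m : ℕ) {T : Matrix (Fin m → n) (Fin m → n) ℂ} (hT0 : 0 ≤ T) (hT1 : T ≤ 1) :
    (tensorPow m ρ * T).trace.re
      ≤ (tensorPow m ρ' * T).trace.re + m * traceNorm (ρ - ρ') := by
  simpa [tensorPow_eq_piTensor] using
    re_trace_piTensor_mul_le_add_sum_traceNorm (fun _ => hρ) (fun _ => hρ') hT0 hT1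

end Telescoping

section ErrorBounds

theorem exp_neg_natCast_mul_coe_sub (n : ℕ) (b : ℝ) (x : EReal) :
    EReal.exp (-((n : EReal) * ((b : EReal) - x)))
      = ENNReal.ofReal (Real.exp (-(n * b))) * EReal.exp x ^ n := by
  have hexp : Real.exp (-(n * b)) = Real.exp (-b) ^ n := by
    rw [← Real.exp_nat_mul, mul_neg]
  rw [← mul_neg, EReal.neg_sub (.inl (EReal.coe_ne_bot b)) (.inl (EReal.coe_ne_top b)),
    EReal.exp_nmul, EReal.exp_add, ← EReal.coe_neg, EReal.exp_coe, mul_pow, hexp,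
    ENNReal.ofReal_pow (Real.exp_pos _).le]

theorem le_natCast_mul_exp_neg_mul_biSup {ι : Type*} {s : Set ι} (hs : s.Nonempty) {N n : ℕ}
    (hn : n ≠ 0) {f : ι → EReal} {x : ℝ≥0∞}
    (h : ∀ i ∈ s, x ≤ (N : ℝ≥0∞) * EReal.exp (-((n : EReal) * f i))) :
    x ≤ (N : ℝ≥0∞) * EReal.exp (-((n : EReal) * ⨆ i ∈ s, f i)) := by
  rcases eq_or_ne N 0 with rfl | hN
  · obtain ⟨i, hi⟩ := hs
    simpa using h i hi
  have hn0 : (0 : EReal) < n := by exact_mod_cast Nat.pos_of_ne_zero hn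
  have key (y : EReal) : x ≤ (N : ℝ≥0∞) * EReal.exp (-((n : EReal) * y))
      ↔ y ≤ -ENNReal.log (x / N) / n := by
    rw [← ENNReal.div_le_iff' (Nat.cast_ne_zero.mpr hN) (ENNReal.natCast_ne_top N),
      ← ENNReal.log_le_log_iff, EReal.log_exp, EReal.le_neg,
      EReal.le_div_iff_mul_le hn0 (EReal.natCast_ne_top n), mul_comm]
  exact (key _).mpr (iSup₂_le fun i hi => (key _).mp (h i hi))

variable {d : Type*} [Fintype d] [DecidableEq d] {𝒩 : Set (Matrix d d ℂ)}
  {σ : Matrix d d ℂ} {F : Finset (Matrix d d ℂ)}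

theorem ofReal_Qnew_le_exp_psi {ρ : Matrix d d ℂ} (hρ : ρ ∈ 𝒩) (σ : Matrix d d ℂ) (t : ℝ) :
    ENNReal.ofReal (Qnew t ρ σ) ≤ EReal.exp (psi 𝒩 σ t) := by
  rw [← ENNReal.exp_log (ENNReal.ofReal (Qnew t ρ σ))]
  exact EReal.exp_monotone
    (le_iSup₂ (f := fun ρ (_ : ρ ∈ 𝒩) => ENNReal.log (ENNReal.ofReal (Qnew t ρ σ))) ρ hρ)

theorem ofReal_exp_mul_sum_Qnew_pow_le (hF : (F : Set (Matrix d d ℂ)) ⊆ 𝒩) (σ : Matrix d d ℂ)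
    (n : ℕ) (b t : ℝ) :
    ENNReal.ofReal (Real.exp (-(n * b)) * ∑ ρ ∈ F, Qnew t ρ σ ^ n)
      ≤ (F.card : ℝ≥0∞) * EReal.exp (-((n : EReal) * ((b : EReal) - psi 𝒩 σ t))) := by
  rw [exp_neg_natCast_mul_coe_sub, ENNReal.ofReal_mul (Real.exp_pos _).le,
    ENNReal.ofReal_sum_of_nonneg fun ρ _ => pow_nonneg (Qnew_nonneg t ρ σ) n, mul_left_comm,
    ← nsmul_eq_mul F.card]
  gcongr
  refine Finset.sum_le_card_nsmul _ _ _ fun ρ hρ => ?_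
  rw [ENNReal.ofReal_pow (Qnew_nonneg t ρ σ)]
  gcongr
  exact ofReal_Qnew_le_exp_psi (hF hρ) σ t

theorem typeII_npTest_le (h𝒩 : ∀ ρ ∈ 𝒩, ρ.PosSemidef) (hσ : σ.PosSemidef)
    (hF : (F : Set (Matrix d d ℂ)) ⊆ 𝒩) {n : ℕ} (hn : n ≠ 0) (a : ℝ) :
    typeII σ n (npTest σ F n a)
      ≤ (F.card : ℝ≥0∞) * EReal.exp (-((n : EReal) * phi 𝒩 σ a)) :=
  le_natCast_mul_exp_neg_mul_biSup ⟨1, by simp⟩ hn fun t ht =>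
    (ENNReal.ofReal_le_ofReal (re_trace_tensorPow_mul_npTest_le hσ.nonneg
      (fun ρ hρ => (h𝒩 ρ (hF hρ)).nonneg) n a ht.1 ht.2)).trans
      (ofReal_exp_mul_sum_Qnew_pow_le hF σ n (a * t) t)

theorem ofReal_re_trace_tensorPow_mul_one_sub_npTest_le (h𝒩 : ∀ ρ ∈ 𝒩, ρ.PosSemidef)
    (hσ : σ.PosSemidef) (hF : (F : Set (Matrix d d ℂ)) ⊆ 𝒩) {ρ : Matrix d d ℂ} (hρ : ρ ∈ F)
    {n : ℕ} (hn : n ≠ 0) (a : ℝ) :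
    ENNReal.ofReal (tensorPow n ρ * (1 - npTest σ F n a)).trace.re
      ≤ (F.card : ℝ≥0∞) * EReal.exp (-((n : EReal) * phiHat 𝒩 σ a)) :=
  le_natCast_mul_exp_neg_mul_biSup ⟨1, by simp⟩ hn fun t ht =>
    (ENNReal.ofReal_le_ofReal (re_trace_tensorPow_mul_one_sub_npTest_le hσ.nonneg
      (fun ρ hρ => (h𝒩 ρ (hF hρ)).nonneg) hρ n a ht.1 ht.2)).trans
      (ofReal_exp_mul_sum_Qnew_pow_le hF σ n (a * (t - 1)) t)

theorem typeI_npTest_le (h𝒩 : ∀ ρ ∈ 𝒩, IsState ρ) (hσ : σ.PosSemidef)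
    (hF : (F : Set (Matrix d d ℂ)) ⊆ 𝒩) {n : ℕ} (hn : n ≠ 0) (a : ℝ) :
    typeI 𝒩 n (npTest σ F n a)
      ≤ (F.card : ℝ≥0∞) * EReal.exp (-((n : EReal) * phiHat 𝒩 σ a))
        + (n : ℝ≥0∞) * netRadius 𝒩 F := by
  refine iSup₂_le fun ρ hρ => ?_
  calc ENNReal.ofReal (tensorPow n ρ * (1 - npTest σ F n a)).trace.re
      ≤ (F.card : ℝ≥0∞) * EReal.exp (-((n : EReal) * phiHat 𝒩 σ a))
        + n * ⨅ ρ' ∈ F, ENNReal.ofReal (traceNorm (ρ - ρ')) := by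
        simp only [ENNReal.mul_iInf_of_ne (Nat.cast_ne_zero.mpr hn) (ENNReal.natCast_ne_top n),
          ENNReal.add_iInf]
        refine le_iInf₂ fun ρ' hρ' => ?_
        have hnet := re_trace_tensorPow_mul_le_add_traceNorm (h𝒩 ρ hρ) (h𝒩 ρ' (hF hρ')) n
          (sub_nonneg.mpr (npTest_le_one σ F n a)) (sub_le_self 1 (npTest_nonneg σ F n a))
        refine (ENNReal.ofReal_le_ofReal hnet).trans (ENNReal.ofReal_add_le.trans ?_)
        rw [ENNReal.ofReal_mul n.cast_nonneg, ENNReal.ofReal_natCast]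
        gcongr
        exact ofReal_re_trace_tensorPow_mul_one_sub_npTest_le
          (fun ρ hρ => (h𝒩 ρ hρ).1) hσ hF hρ' hn a
    _ ≤ _ := by
        gcongr
        exact le_iSup₂ (f := fun ρ (_ : ρ ∈ 𝒩) =>
          ⨅ ρ' ∈ F, ENNReal.ofReal (traceNorm (ρ - ρ'))) ρ hρ

theorem netRadius_le {r : ℝ} (h : ∀ ρ ∈ 𝒩, ∃ ρ' ∈ F, traceNorm (ρ - ρ') ≤ r) :
    netRadius 𝒩 F ≤ ENNReal.ofReal r := by
  refine iSup₂_le fun ρ hρ => ?_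
  obtain ⟨ρ', hρ', hle⟩ := h ρ hρ
  exact iInf₂_le_of_le ρ' hρ' (ENNReal.ofReal_le_ofReal hle)

end ErrorBounds

section ExponentialRates

open ExpGrowth

theorem expRate_eq_expGrowthSup (e : ℕ → ℝ≥0∞) : expRate e = expGrowthSup e := by
  refine congrArg (limsup · atTop) (funext fun n => ?_)
  rw [one_div, EReal.coe_inv, EReal.coe_natCast, mul_comm, EReal.div_eq_inv_mul, mul_comm]

theorem expGrowthSup_natCast_le_zero : expGrowthSup (fun n : ℕ => (n : ℝ≥0∞)) ≤ 0 := by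
  refine EReal.le_of_forall_lt_iff_le.mp fun r hr => ?_
  have hr0 : 0 < r := EReal.coe_pos.mp hr
  have hbound (n : ℕ) : (n : ℝ≥0∞) ≤ ENNReal.ofReal r⁻¹ * EReal.exp (r * n) := by
    rw [← EReal.coe_natCast, ← EReal.coe_mul, EReal.exp_coe,
      ← ENNReal.ofReal_mul (inv_pos.mpr hr0).le, ← ENNReal.ofReal_natCast]
    refine ENNReal.ofReal_le_ofReal ((le_inv_mul_iff₀ hr0).mpr ?_)
    linarith [Real.add_one_le_exp (r * n)]
  exact (expGrowthSup_le_of_eventually_le ENNReal.ofReal_ne_top (.of_forall hbound)).trans_eq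
    expGrowthSup_exp

theorem expGrowthSup_mul_exp_neg_mul_le {u : ℕ → ℝ≥0∞} {c : ℝ} (hu : expGrowthSup u ≤ c)
    (y : EReal) :
    expGrowthSup (fun n => u n * EReal.exp (-((n : EReal) * y))) ≤ -(y - c) := by
  rcases eq_or_ne y ⊥ with rfl | hy
  · simp
  have hexp : expGrowthSup (fun n : ℕ => EReal.exp (-((n : EReal) * y))) = -y := by
    simp_rw [← mul_neg, mul_comm _ (-y)]
    exact expGrowthSup_exp
  have hu_top : expGrowthSup u ≠ ⊤ := (hu.trans_lt (EReal.coe_lt_top c)).ne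
  calc expGrowthSup (fun n => u n * EReal.exp (-((n : EReal) * y)))
      ≤ expGrowthSup u + -y := by
        rw [← hexp]
        exact expGrowthSup_mul_le (.inr (by rwa [hexp, Ne, EReal.neg_eq_top_iff])) (.inl hu_top)
    _ ≤ c + -y := by gcongr
    _ = -(y - c) := by
        rw [EReal.neg_sub (.inr (EReal.coe_ne_bot c)) (.inr (EReal.coe_ne_top c)), add_comm]

theorem expGrowthSup_natCast_le_of_le_pow {N : ℕ → ℕ} {κ : ℝ} (hκ : 0 ≤ κ) (D : ℕ)
    (hN : ∀ᶠ n : ℕ in atTop, (N n : ℝ) ≤ (1 + 2 / Real.exp (-(n * κ))) ^ D) :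
    expGrowthSup (fun n => (N n : ℝ≥0∞)) ≤ ((κ * D : ℝ) : EReal) := by
  refine (expGrowthSup_le_of_eventually_le (b := ENNReal.ofReal (3 ^ D)) ENNReal.ofReal_ne_top
    (hN.mono fun n hn => ?_)).trans_eq expGrowthSup_exp
  rw [← EReal.coe_natCast, ← EReal.coe_mul, EReal.exp_coe, ← ENNReal.ofReal_mul (by positivity),
    ← ENNReal.ofReal_natCast]
  refine ENNReal.ofReal_le_ofReal ?_
  have hbase : 1 + 2 / Real.exp (-(n * κ)) ≤ 3 * Real.exp (n * κ) := by
    rw [Real.exp_neg, div_inv_eq_mul]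
    linarith [Real.one_le_exp (mul_nonneg n.cast_nonneg hκ)]
  calc (N n : ℝ) ≤ (1 + 2 / Real.exp (-(n * κ))) ^ D := hn
    _ ≤ (3 * Real.exp (n * κ)) ^ D := by gcongr
    _ = 3 ^ D * Real.exp (κ * D * n) := by
        rw [mul_pow, ← Real.exp_nat_mul]
        ring_nf

theorem expGrowthSup_add_natCast_mul_exp_le {u : ℕ → ℝ≥0∞} {c : ℝ} (hu : expGrowthSup u ≤ c)
    (y : EReal) (κ : ℝ) :
    expGrowthSup (fun n : ℕ => u n * EReal.exp (-((n : EReal) * y))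
      + (n : ℝ≥0∞) * ENNReal.ofReal (Real.exp (-(n * κ)))) ≤ -(min (κ : EReal) (y - c)) := by
  have hexp (n : ℕ) :
      ENNReal.ofReal (Real.exp (-(n * κ))) = EReal.exp (-((n : EReal) * (κ : EReal))) := by
    rw [← EReal.coe_natCast, ← EReal.coe_mul, ← EReal.coe_neg, EReal.exp_coe]
  have hκ : expGrowthSup (fun n : ℕ => (n : ℝ≥0∞) * EReal.exp (-((n : EReal) * (κ : EReal))))
      ≤ -(κ : EReal) := by
    simpa using expGrowthSup_mul_exp_neg_mul_le (c := 0) expGrowthSup_natCast_le_zero κ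
  simp_rw [hexp]
  refine expGrowthSup_add.trans_le ?_
  rw [EReal.neg_strictAnti.antitone.map_min, sup_comm]
  exact max_le_max hκ (expGrowthSup_mul_exp_neg_mul_le hu y)

end ExponentialRates

end CompositeStein

theorem mainTheorem6_general {d : Type*} [Fintype d] [DecidableEq d] (𝒩 : Set (Matrix d d ℂ))
    (hstate : ∀ ρ ∈ 𝒩, CompositeStein.IsState ρ) (σ : Matrix d d ℂ) (hσ : σ.PosSemidef) :
    (∀ (n : ℕ), 1 ≤ n → ∀ (F : Finset (Matrix d d ℂ)), (F : Set (Matrix d d ℂ)) ⊆ 𝒩 →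
      ∀ a : ℝ,
        CompositeStein.typeI 𝒩 n (CompositeStein.npTest σ F n a)
            ≤ (F.card : ENNReal) * EReal.exp (-((n : EReal) * CompositeStein.phiHat 𝒩 σ a))
              + (n : ENNReal) * CompositeStein.netRadius 𝒩 F ∧
        CompositeStein.typeII σ n (CompositeStein.npTest σ F n a)
            ≤ (F.card : ENNReal) * EReal.exp (-((n : EReal) * CompositeStein.phi 𝒩 σ a))) ∧
    (∀ (D : ℕ) (κ : ℝ), 0 < κ → ∀ (Nn : ℕ → Finset (Matrix d d ℂ)),
        (∀ n : ℕ, 1 ≤ n →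
          (Nn n : Set (Matrix d d ℂ)) ⊆ 𝒩 ∧
          ((Nn n).card : ℝ) ≤ (1 + 2 / Real.exp (-(n * κ))) ^ D ∧
          ∀ ρ ∈ 𝒩, ∃ ρ' ∈ Nn n, CompositeStein.traceNorm (ρ - ρ') < Real.exp (-(n * κ))) →
        ∀ a : ℝ,
          CompositeStein.expRate
              (fun n => CompositeStein.typeI 𝒩 n (CompositeStein.npTest σ (Nn n) n a))
            ≤ -(min (κ : EReal) (CompositeStein.phiHat 𝒩 σ a - ((κ * D : ℝ) : EReal))) ∧
          CompositeStein.expRate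
              (fun n => CompositeStein.typeII σ n (CompositeStein.npTest σ (Nn n) n a))
            ≤ -(CompositeStein.phi 𝒩 σ a - ((κ * D : ℝ) : EReal))) := by
  have typeI_le {n : ℕ} (hn : 1 ≤ n) {F : Finset (Matrix d d ℂ)} (hF : ↑F ⊆ 𝒩) (a : ℝ) :=
    CompositeStein.typeI_npTest_le hstate hσ hF (Nat.one_le_iff_ne_zero.mp hn) a
  have typeII_le {n : ℕ} (hn : 1 ≤ n) {F : Finset (Matrix d d ℂ)} (hF : ↑F ⊆ 𝒩) (a : ℝ) :=
    CompositeStein.typeII_npTest_le (fun ρ hρ => (hstate ρ hρ).1) hσ hF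
      (Nat.one_le_iff_ne_zero.mp hn) a
  refine ⟨fun n hn F hF a => ⟨typeI_le hn hF a, typeII_le hn hF a⟩, fun D κ hκ Nn hNn a => ?_⟩
  have hcard := CompositeStein.expGrowthSup_natCast_le_of_le_pow hκ.le D
    ((eventually_ge_atTop 1).mono fun n hn => (hNn n hn).2.1)
  simp only [CompositeStein.expRate_eq_expGrowthSup]
  constructor
  · refine (ExpGrowth.expGrowthSup_eventually_monotone ?_).trans
      (CompositeStein.expGrowthSup_add_natCast_mul_exp_le hcard (CompositeStein.phiHat 𝒩 σ a) κ)
    filter_upwards [eventually_ge_atTop 1] with n hn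
    refine (typeI_le hn (hNn n hn).1 a).trans ?_
    gcongr
    exact CompositeStein.netRadius_le fun ρ hρ => ((hNn n hn).2.2 ρ hρ).imp fun _ h => ⟨h.1, h.2.le⟩
  · refine (ExpGrowth.expGrowthSup_eventually_monotone ?_).trans
      (CompositeStein.expGrowthSup_mul_exp_neg_mul_le hcard (CompositeStein.phi 𝒩 σ a))
    filter_upwards [eventually_ge_atTop 1] with n hn
    exact typeII_le hn (hNn n hn).1 a

theorem mainTheorem6 {d : Type*} [Fintype d] [DecidableEq d]
    (𝒩 : Set (Matrix d d ℂ)) (h𝒩 : 𝒩.Nonempty)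
    (hstate : ∀ ρ ∈ 𝒩, CompositeStein.IsState ρ)
    (σ : Matrix d d ℂ) (hσ : σ.PosSemidef)
    (hsupp : ∀ ρ ∈ 𝒩, CompositeStein.supp ρ ≤ CompositeStein.supp σ) :
    -- the bounds at every finite `n`, for every finite subset `F = 𝒩(n)` of `𝒩`
    (∀ (n : ℕ), 1 ≤ n → ∀ (F : Finset (Matrix d d ℂ)), (F : Set (Matrix d d ℂ)) ⊆ 𝒩 →
      ∀ a : ℝ,
        CompositeStein.typeI 𝒩 n (CompositeStein.npTest σ F n a)
            ≤ (F.card : ENNReal) * EReal.exp (-((n : EReal) * CompositeStein.phiHat 𝒩 σ a))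
              + (n : ENNReal) * CompositeStein.netRadius 𝒩 F ∧
        CompositeStein.typeII σ n (CompositeStein.npTest σ F n a)
            ≤ (F.card : ENNReal) * EReal.exp (-((n : EReal) * CompositeStein.phi 𝒩 σ a))) ∧
    -- the asymptotic rates for `e^{-nκ}`-nets `𝒩(n)` of cardinality at most
    -- `(1 + 2 / e^{-nκ})^D`, where `D` is the real dimension of a space `V` that contains `𝒩`
    (∀ (V : Submodule ℝ (Matrix d d ℂ)), 𝒩 ⊆ (V : Set (Matrix d d ℂ)) →
      ∀ κ : ℝ, 0 < κ → ∀ (Nn : ℕ → Finset (Matrix d d ℂ)),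
        (∀ n : ℕ, 1 ≤ n →
          (Nn n : Set (Matrix d d ℂ)) ⊆ 𝒩 ∧
          ((Nn n).card : ℝ) ≤ (1 + 2 / Real.exp (-(n * κ))) ^ Module.finrank ℝ V ∧
          ∀ ρ ∈ 𝒩, ∃ ρ' ∈ Nn n, CompositeStein.traceNorm (ρ - ρ') < Real.exp (-(n * κ))) →
        ∀ a : ℝ,
          CompositeStein.expRate
              (fun n => CompositeStein.typeI 𝒩 n (CompositeStein.npTest σ (Nn n) n a))
            ≤ -(min (κ : EReal)
                (CompositeStein.phiHat 𝒩 σ a - ((κ * Module.finrank ℝ V : ℝ) : EReal))) ∧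
          CompositeStein.expRate
              (fun n => CompositeStein.typeII σ n (CompositeStein.npTest σ (Nn n) n a))
            ≤ -(CompositeStein.phi 𝒩 σ a - ((κ * Module.finrank ℝ V : ℝ) : EReal))) := by
  obtain ⟨hbounds, hrates⟩ := mainTheorem6_general 𝒩 hstate σ hσ
  exact ⟨hbounds, fun V _ => hrates (Module.finrank ℝ V)⟩
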